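/- Let $n\ge 8$. For a simple graph $G$ of order $n$, let $\alpha(G)$ be its stability number (the maximum size of a stable set) and $F(G)$ its Fibonacci index (the number of stable sets of $G$, including the empty set). Let $\mathcal P_{\mathcal C(n)}\subset\mathbb R^2$ be the convex hull of all points $(\alpha(G),F(G))$, where $G$ ranges over the connected graphs of order $n$. Then $\mathcal P_{\mathcal C(n)}$ has exactly $n-1$ facets, and they are defined by the inequalities $$y\ \ge\ (2^k-1)\,x+2^k(1-k)+n,\qquad k=1,2,\dots,n-2,$$ $$y\ \le\ \frac{2^{n-1}-n}{n-2}\,(x-1)+n+1 .$$ That is, these $n-1$ inequalities form a complete and minimal description of $\mathcal P_{\mathcal C(n)}$ (it is their solution set, and not the solution set of any proper subsystem), each of them defines a facet (the set of points of $\mathcal P_{\mathcal C(n)}$ where it holds with equality), and every facet arises in this way. Moreover, the line $y=\frac{2^{n-1}-n}{n-2}(x-1)+n+1$ is the line through the two points $(\alpha(G),F(G))$ corresponding to the complete graph $G=K_n$ and the star $G=S_n$. -/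

import Mathlib

/-- The Fibonacci index (Merrifield-Simmons index) of a graph: the number of its stable
(independent) sets of vertices, the empty set included. -/
noncomputable def fibonacciIndex {V : Type*} (G : SimpleGraph V) : ℕ :=
  Nat.card {s : Finset V // G.IsIndepSet (s : Set V)}

/-- The point `(α(G), F(G))` of the plane that corresponds to the graph `G`. -/
noncomputable def graphPoint {V : Type*} (G : SimpleGraph V) : ℝ × ℝ :=
  ((G.indepNum : ℝ), (fibonacciIndex G : ℝ))

/-- The polytope of the connected graphs of order `n`: the convex hull of all points
`(α(G), F(G))`, where `G` is a connected graph of order `n`. -/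
noncomputable def connectedPolytope (n : ℕ) : Set (ℝ × ℝ) :=
  convexHull ℝ {p : ℝ × ℝ | ∃ G : SimpleGraph (Fin n), G.Connected ∧ p = graphPoint G}

/-- `B` is a facet of the polytope `P`: a nonempty (exposed) face of `P` whose dimension is one
less than that of `P`. -/
def IsFacet {E : Type*} [NormedAddCommGroup E] [NormedSpace ℝ E] (P B : Set E) : Prop :=
  IsExposed ℝ P B ∧ B.Nonempty ∧
    Module.finrank ℝ (vectorSpan ℝ B) + 1 = Module.finrank ℝ (vectorSpan ℝ P)

/-- The right-hand side `(2 ^ k - 1) x + 2 ^ k (1 - k) + n` of the lower inequalities. -/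
noncomputable def lowerBound (n k : ℕ) (x : ℝ) : ℝ :=
  ((2 : ℝ) ^ k - 1) * x + (2 : ℝ) ^ k * (1 - (k : ℝ)) + (n : ℝ)

/-- The right-hand side `(2 ^ (n - 1) - n) / (n - 2) * (x - 1) + n + 1` of the upper inequality. -/
noncomputable def upperBound (n : ℕ) (x : ℝ) : ℝ :=
  ((2 : ℝ) ^ (n - 1) - (n : ℝ)) / ((n : ℝ) - 2) * (x - 1) + (n : ℝ) + 1

/-- The closed half-planes given by the lower inequalities, for `k = 1, …, n - 2`, and by the
upper inequality. -/
def halfPlanes (n : ℕ) : Set (Set (ℝ × ℝ)) :=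
  {H | ∃ k : ℕ, 1 ≤ k ∧ k ≤ n - 2 ∧ H = {p : ℝ × ℝ | lowerBound n k p.1 ≤ p.2}} ∪
    {{p : ℝ × ℝ | p.2 ≤ upperBound n p.1}}

/-! The polygon has the vertices `(k, 2 ^ k - k + n)` for `1 ≤ k ≤ n - 1`, realised by complete
split graphs: a stable set of size `k`, with every other pair adjacent. The cases `k = 1` and `k = n
- 1` are the complete graph and the star.

Lower side: if `S` is a maximum stable set of `G`, the subsets of `S` and the singletons are stable
in `G`, so `F(G) ≥ 2 ^ α - α + n` (`lowerVertex_le_graphPoint`). This bound is strictly convex in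
`α`, and the lower inequalities are the chords between consecutive integers
(`lowerBound_add_one_le`).

Upper side, the hard one (`fibonacciIndex_le_upperBound`): deleting a vertex `v` gives `F(G) = F(G -
v) + F(G - N[v])`, and `α` drops in the last term. Induction gives two exponential bounds in `α` and
the order, valid for all graphs. Connectedness enters through a vertex of large degree, which makes
the last term small; the remaining slack is elementary numerics, with a few small cases.

Convexity then identifies the polytope with the intersection of the half-planes. A linear functional
that is not zero has no maximum at an interior point, so each one-dimensional exposed face lies on
one of the bounding lines. -/

/-! ### Counting stable sets by deleting vertices -/

section StableSets

variable {V : Type*} {G : SimpleGraph V}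

open Classical in
/-- The stable sets of `G` that are contained in `W`. -/
noncomputable def stableIn (G : SimpleGraph V) (W : Finset V) : Finset (Finset V) :=
  {s ∈ W.powerset | G.IsIndepSet (s : Set V)}

lemma mem_stableIn {W s : Finset V} : s ∈ stableIn G W ↔ s ⊆ W ∧ G.IsIndepSet (s : Set V) := by
  simp [stableIn]

lemma fibonacciIndex_eq_card_stableIn [Fintype V] (G : SimpleGraph V) :
    fibonacciIndex G = (stableIn G Finset.univ).card := by
  classical
  rw [fibonacciIndex, Nat.card_eq_fintype_card, Fintype.card_subtype]
  congr 1

lemma card_stableIn_le_two_pow (W : Finset V) : (stableIn G W).card ≤ 2 ^ W.card := by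
  classical
  rw [← Finset.card_powerset]
  exact Finset.card_filter_le _ _

lemma stableIn_empty : (stableIn G ∅).card = 1 := by
  classical
  have h : stableIn G ∅ = {∅} := by
    ext s
    simp only [mem_stableIn, Finset.subset_empty, Finset.mem_singleton, and_iff_left_iff_imp]
    rintro rfl
    simp
  rw [h, Finset.card_singleton]

lemma stableIn_mono {W W' : Finset V} (h : W ⊆ W') :
    (stableIn G W).card ≤ (stableIn G W').card := by
  apply Finset.card_le_card
  intro s hs
  rw [mem_stableIn] at hs ⊢
  exact ⟨hs.1.trans h, hs.2⟩

open Classical in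
/-- The vertices of `W` outside the closed neighbourhood of `v`. -/
noncomputable def awayFrom (G : SimpleGraph V) (W : Finset V) (v : V) : Finset V :=
  {w ∈ W | w ≠ v ∧ ¬ G.Adj v w}

lemma mem_awayFrom {W : Finset V} {v w : V} :
    w ∈ awayFrom G W v ↔ w ∈ W ∧ w ≠ v ∧ ¬ G.Adj v w := by
  simp [awayFrom]

open Classical in
/-- The number of neighbours of `v` in `W`. -/
noncomputable def degIn (G : SimpleGraph V) (W : Finset V) (v : V) : ℕ :=
  {w ∈ W | G.Adj v w}.card

lemma isIndepSet_insert_of_subset_awayFrom [DecidableEq V] {W s : Finset V} {v : V}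
    (hs : s ⊆ awayFrom G W v) (hi : G.IsIndepSet (s : Set V)) :
    G.IsIndepSet ((insert v s : Finset V) : Set V) := by
  rw [Finset.coe_insert, SimpleGraph.IsIndepSet, Set.pairwise_insert]
  refine ⟨hi, fun b hb _ => ?_⟩
  have := (mem_awayFrom.1 (hs hb)).2.2
  exact ⟨this, fun h => this h.symm⟩

lemma notMem_of_subset_awayFrom {W s : Finset V} {v : V} (hs : s ⊆ awayFrom G W v) : v ∉ s :=
  fun h => (mem_awayFrom.1 (hs h)).2.1 rfl

/-- Split by whether `v` belongs to the stable set; removing `v` from those that contain it leaves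
the stable sets outside its closed neighbourhood. -/
lemma card_stableIn_eq_add [DecidableEq V] {W : Finset V} {v : V} (hv : v ∈ W) :
    (stableIn G W).card = (stableIn G (W.erase v)).card + (stableIn G (awayFrom G W v)).card := by
  have hinj : Set.InjOn (insert v) (stableIn G (awayFrom G W v) : Set (Finset V)) := by
    intro s hs t ht hst
    have hs' := notMem_of_subset_awayFrom (mem_stableIn.1 hs).1
    have ht' := notMem_of_subset_awayFrom (mem_stableIn.1 ht).1
    rw [← Finset.erase_insert hs', ← Finset.erase_insert ht']
    exact congrArg (fun u => Finset.erase u v) hst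
  rw [← Finset.card_image_of_injOn hinj, ← Finset.card_union_of_disjoint]
  · congr 1
    ext s
    simp only [Finset.mem_union, Finset.mem_image, mem_stableIn]
    constructor
    · rintro ⟨hs, hi⟩
      by_cases hvs : v ∈ s
      · refine Or.inr ⟨s.erase v, ⟨fun w hw => ?_, hi.mono (by simp)⟩, Finset.insert_erase hvs⟩
        rw [Finset.mem_erase] at hw
        exact mem_awayFrom.2 ⟨hs hw.2, hw.1, hi hvs hw.2 hw.1.symm⟩
      · exact Or.inl ⟨Finset.subset_erase.2 ⟨hs, hvs⟩, hi⟩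
    · rintro (⟨hs, hi⟩ | ⟨s, ⟨hs, hi⟩, rfl⟩)
      · exact ⟨hs.trans (Finset.erase_subset _ _), hi⟩
      · refine ⟨Finset.insert_subset hv fun w hw => (mem_awayFrom.1 (hs hw)).1, ?_⟩
        exact isIndepSet_insert_of_subset_awayFrom hs hi
  · rw [Finset.disjoint_left]
    intro s hs hs'
    obtain ⟨t, -, rfl⟩ := Finset.mem_image.1 hs'
    exact Finset.notMem_erase v W ((mem_stableIn.1 hs).1 (Finset.mem_insert_self v t))

lemma card_awayFrom {W : Finset V} {v : V} (hv : v ∈ W) :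
    (awayFrom G W v).card + degIn G W v + 1 = W.card := by
  classical
  have h1 := Finset.card_filter_add_card_filter_not (s := W.erase v) (fun w => G.Adj v w)
  rw [Finset.card_erase_of_mem hv] at h1
  have h2 : {w ∈ W.erase v | ¬ G.Adj v w} = awayFrom G W v := by
    ext w
    simp only [Finset.mem_filter, Finset.mem_erase, mem_awayFrom]
    tauto
  have h3 : {w ∈ W.erase v | G.Adj v w} = {w ∈ W | G.Adj v w} := by
    ext w
    simp only [Finset.mem_filter, Finset.mem_erase, and_congr_left_iff, and_iff_right_iff_imp]
    intro h _
    exact h.ne'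
  have h4 : degIn G W v = {w ∈ W.erase v | G.Adj v w}.card := by
    rw [h3, degIn]
  have := Finset.card_pos.2 ⟨v, hv⟩
  rw [h2, ← h4] at h1
  omega

/-- Every stable set contained in `W` has at most `k` elements. -/
def StableBound (G : SimpleGraph V) (W : Finset V) (k : ℕ) : Prop :=
  ∀ s ∈ stableIn G W, s.card ≤ k

lemma StableBound.mono {W W' : Finset V} {k : ℕ} (h : StableBound G W k) (hW : W' ⊆ W) :
    StableBound G W' k := fun s hs =>
  h s (mem_stableIn.2 ⟨(mem_stableIn.1 hs).1.trans hW, (mem_stableIn.1 hs).2⟩)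

lemma StableBound.pos {W : Finset V} {v : V} {k : ℕ} (h : StableBound G W k) (hv : v ∈ W) :
    1 ≤ k := by
  simpa using h {v} (mem_stableIn.2 ⟨by simpa using hv, by simp [SimpleGraph.IsIndepSet]⟩)

lemma StableBound.awayFrom {W : Finset V} {v : V} {k : ℕ} (h : StableBound G W k) (hv : v ∈ W) :
    StableBound G (awayFrom G W v) (k - 1) := by
  classical
  intro s hs
  rw [mem_stableIn] at hs
  have := h (insert v s) (mem_stableIn.2
    ⟨Finset.insert_subset hv fun w hw => (mem_awayFrom.1 (hs.1 hw)).1,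
      isIndepSet_insert_of_subset_awayFrom hs.1 hs.2⟩)
  rw [Finset.card_insert_of_notMem (notMem_of_subset_awayFrom hs.1)] at this
  omega

lemma card_stableIn_eq_two_mul_of_degIn_eq_zero {W : Finset V} {v : V} (hv : v ∈ W)
    (hd : degIn G W v = 0) : (stableIn G W).card = 2 * (stableIn G (awayFrom G W v)).card := by
  classical
  have : W.erase v = awayFrom G W v := by
    symm
    apply Finset.eq_of_subset_of_card_le
    · intro w hw
      rw [mem_awayFrom] at hw
      exact Finset.mem_erase.2 ⟨hw.2.1, hw.1⟩
    · have := card_awayFrom (G := G) hv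
      rw [Finset.card_erase_of_mem hv]
      omega
  rw [card_stableIn_eq_add hv, this, two_mul]

/-- Apply the recursion at `v` and then at its only neighbour `w`: each of the three resulting terms
counts stable sets inside `awayFrom G W v`. -/
lemma card_stableIn_le_three_mul_of_degIn_eq_one {W : Finset V} {v : V} (hv : v ∈ W)
    (hd : degIn G W v = 1) : (stableIn G W).card ≤ 3 * (stableIn G (awayFrom G W v)).card := by
  classical
  obtain ⟨w, hw⟩ := Finset.card_eq_one.1 hd
  have hmem : ∀ x, x ∈ W ∧ G.Adj v x ↔ x = w := fun x => by
    simpa using congrArg (x ∈ ·) hw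
  have hvw := (hmem w).2 rfl
  have hsub : (W.erase v).erase w ⊆ awayFrom G W v := by
    intro x hx
    simp only [Finset.mem_erase] at hx
    exact mem_awayFrom.2 ⟨hx.2.2, hx.2.1, fun h => hx.1 ((hmem x).1 ⟨hx.2.2, h⟩)⟩
  have hsub' : awayFrom G (W.erase v) w ⊆ (W.erase v).erase w := by
    intro x hx
    rw [mem_awayFrom] at hx
    exact Finset.mem_erase.2 ⟨hx.2.1, hx.1⟩
  have h1 := card_stableIn_eq_add (G := G) hv
  have h2 := card_stableIn_eq_add (G := G) (Finset.mem_erase.2 ⟨hvw.2.ne', hvw.1⟩)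
  have h3 := stableIn_mono (G := G) hsub
  have h4 := stableIn_mono (G := G) hsub'
  omega

/-- The constants make the bound exact on disjoint unions of `K₁` and `K₂`: `4/3 * 3/2 = 2` and `4/3
* (3/2)^2 = 3`. The same identities close the induction, for an isolated vertex and for a vertex
with a neighbour. -/
lemma card_stableIn_le_geom {W : Finset V} {k : ℕ} (h : StableBound G W k) :
    ((stableIn G W).card : ℝ) ≤ (4 / 3) ^ k * (3 / 2) ^ W.card := by
  classical
  induction hN : W.card using Nat.strong_induction_on generalizing W k with
  | _ N ih =>
  obtain rfl | ⟨v, hv⟩ := W.eq_empty_or_nonempty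
  · obtain rfl : N = 0 := by simpa using hN.symm
    simpa [stableIn_empty] using one_le_pow₀ (by norm_num : (1 : ℝ) ≤ 4 / 3)
  obtain ⟨m, rfl⟩ : ∃ m, k = m + 1 := ⟨k - 1, by have := h.pos hv; omega⟩
  have hc := card_awayFrom (G := G) hv
  have ha := ih _ (by omega) (h.awayFrom hv) rfl
  rw [Nat.add_sub_cancel] at ha
  rcases Nat.eq_zero_or_pos (degIn G W v) with hd | hd
  · rw [card_stableIn_eq_two_mul_of_degIn_eq_zero hv hd]
    have : N = (awayFrom G W v).card + 1 := by omega
    rw [this, pow_succ, pow_succ]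
    push_cast
    nlinarith
  · have he := ih _ (by rw [Finset.card_erase_of_mem hv]; omega)
      (h.mono (Finset.erase_subset v W)) rfl
    rw [card_stableIn_eq_add hv]
    obtain ⟨M, rfl⟩ : ∃ M, N = M + 2 := ⟨N - 2, by omega⟩
    rw [Finset.card_erase_of_mem hv, hN, show M + 2 - 1 = M + 1 by omega] at he
    have hm : ((3 : ℝ) / 2) ^ (awayFrom G W v).card ≤ (3 / 2) ^ M :=
      pow_le_pow_right₀ (by norm_num) (by omega)
    have hm' := mul_le_mul_of_nonneg_left hm (by positivity : (0 : ℝ) ≤ (4 / 3) ^ m)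
    rw [pow_succ, pow_succ] at he ⊢
    rw [pow_succ (3 / 2 : ℝ) M]
    push_cast
    nlinarith

/-- Companion bound for small `k`, exact on disjoint unions of `K₂` and `K₃`: `27/16 * (4/3)^2 = 3`
and `27/16 * (4/3)^3 = 4`. Degrees `0`, `1` and at least `2` are treated separately. -/
lemma card_stableIn_le_geom' {W : Finset V} {k : ℕ} (h : StableBound G W k) :
    ((stableIn G W).card : ℝ) ≤ (27 / 16) ^ k * (4 / 3) ^ W.card := by
  classical
  induction hN : W.card using Nat.strong_induction_on generalizing W k with
  | _ N ih =>
  obtain rfl | ⟨v, hv⟩ := W.eq_empty_or_nonempty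
  · obtain rfl : N = 0 := by simpa using hN.symm
    simpa [stableIn_empty] using one_le_pow₀ (by norm_num : (1 : ℝ) ≤ 27 / 16)
  obtain ⟨m, rfl⟩ : ∃ m, k = m + 1 := ⟨k - 1, by have := h.pos hv; omega⟩
  have hc := card_awayFrom (G := G) hv
  have ha := ih _ (by omega) (h.awayFrom hv) rfl
  rw [Nat.add_sub_cancel] at ha
  obtain hd | hd | hd : degIn G W v = 0 ∨ degIn G W v = 1 ∨ 2 ≤ degIn G W v := by omega
  · rw [card_stableIn_eq_two_mul_of_degIn_eq_zero hv hd]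
    have : N = (awayFrom G W v).card + 1 := by omega
    rw [this, pow_succ, pow_succ]
    push_cast
    have : (0 : ℝ) ≤ (27 / 16) ^ m * (4 / 3) ^ (awayFrom G W v).card := by positivity
    nlinarith
  · have h3 : ((stableIn G W).card : ℝ) ≤ 3 * (stableIn G (awayFrom G W v)).card := by
      exact_mod_cast card_stableIn_le_three_mul_of_degIn_eq_one hv hd
    have : N = (awayFrom G W v).card + 1 + 1 := by omega
    rw [this, pow_succ, pow_succ, pow_succ]
    nlinarith
  · have he := ih _ (by rw [Finset.card_erase_of_mem hv]; omega)
      (h.mono (Finset.erase_subset v W)) rfl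
    rw [card_stableIn_eq_add hv]
    obtain ⟨M, rfl⟩ : ∃ M, N = M + 3 := ⟨N - 3, by omega⟩
    rw [Finset.card_erase_of_mem hv, hN, show M + 3 - 1 = M + 2 by omega] at he
    have hm : ((4 : ℝ) / 3) ^ (awayFrom G W v).card ≤ (4 / 3) ^ M :=
      pow_le_pow_right₀ (by norm_num) (by omega)
    have hm' := mul_le_mul_of_nonneg_left hm (by positivity : (0 : ℝ) ≤ (27 / 16) ^ m)
    rw [pow_succ, pow_add] at he ⊢
    push_cast
    nlinarith

lemma stableBound_univ [Fintype V] (G : SimpleGraph V) :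
    StableBound G Finset.univ G.indepNum := fun _ hs =>
  (mem_stableIn.1 hs).2.card_le_indepNum

lemma degIn_univ [Fintype V] [DecidableRel G.Adj] (v : V) :
    degIn G Finset.univ v = G.degree v := by
  classical
  rw [degIn, ← SimpleGraph.card_neighborFinset_eq_degree]
  congr 1
  ext w
  simp

lemma card_le_card_edgeFinset_add_one [Fintype V] [DecidableEq V] [DecidableRel G.Adj]
    (hG : G.Connected) : Fintype.card V ≤ G.edgeFinset.card + 1 := by
  have := hG.card_vert_le_card_edgeSet_add_one
  rwa [Nat.card_eq_fintype_card, Nat.card_eq_fintype_card, ← SimpleGraph.edgeFinset_card] at this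

/-- In a connected graph, the complement of a maximum stable set meets all edges, so that it
contains a vertex of large degree. -/
lemma exists_card_le_mul_degree [Fintype V] [DecidableEq V] [DecidableRel G.Adj]
    (hG : G.Connected) (hV : 2 ≤ Fintype.card V) :
    ∃ v, Fintype.card V - 1 ≤ (Fintype.card V - G.indepNum) * G.degree v := by
  obtain ⟨S, hS⟩ := G.exists_isNIndepSet_indepNum
  by_contra! hcon
  have hsub : G.edgeFinset ⊆ Sᶜ.biUnion fun v => G.incidenceFinset v := by
    intro e he
    induction e with
    | _ a b =>
    have hab : G.Adj a b := by simpa using he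
    rw [Finset.mem_biUnion]
    by_cases ha : a ∈ S
    · refine ⟨b, Finset.mem_compl.2 fun hb => hS.1 ha hb hab.ne hab, ?_⟩
      rw [SimpleGraph.mem_incidenceFinset]
      exact ⟨hab, by simp⟩
    · refine ⟨a, Finset.mem_compl.2 ha, ?_⟩
      rw [SimpleGraph.mem_incidenceFinset]
      exact ⟨hab, by simp⟩
  have h1 := card_le_card_edgeFinset_add_one hG
  have h2 := (Finset.card_le_card hsub).trans Finset.card_biUnion_le
  simp only [SimpleGraph.card_incidenceFinset_eq_degree] at h2
  have hc : Sᶜ.card = Fintype.card V - G.indepNum := by rw [Finset.card_compl, hS.2]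
  have hne : Sᶜ.Nonempty := by
    rw [Finset.nonempty_iff_ne_empty]
    intro h0
    rw [h0, Finset.sum_empty] at h2
    omega
  obtain ⟨v, hv, hmax⟩ := Finset.exists_max_image Sᶜ (fun v => G.degree v) hne
  have h3 := Finset.sum_le_card_nsmul Sᶜ (fun v => G.degree v) _ hmax
  have h4 := hcon v
  rw [hc, smul_eq_mul] at h3
  omega

end StableSets

/-! ### Sharper estimates from a vertex of large degree -/

section UpperBound

variable {V : Type*} {G : SimpleGraph V}

lemma card_stableIn_le_succ_of_stableBound_one {W : Finset V} (h : StableBound G W 1) :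
    (stableIn G W).card ≤ W.card + 1 := by
  classical
  induction hN : W.card generalizing W with
  | zero =>
    rw [Finset.card_eq_zero] at hN
    rw [hN, stableIn_empty]
  | succ N ih =>
    obtain ⟨v, hv⟩ : W.Nonempty := Finset.card_pos.1 (by omega)
    have h1 := ih (h.mono (Finset.erase_subset v W)) (by rw [Finset.card_erase_of_mem hv]; omega)
    have h2 : (stableIn G (awayFrom G W v)).card ≤ 1 := by
      rw [Finset.card_le_one]
      intro s hs t ht
      have hs' := h.awayFrom hv s hs
      have ht' := h.awayFrom hv t ht
      rw [Nat.sub_self, Nat.le_zero, Finset.card_eq_zero] at hs' ht'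
      rw [hs', ht']
    rw [card_stableIn_eq_add hv]
    omega

lemma card_awayFrom_le {W : Finset V} {v : V} {d : ℕ} (hv : v ∈ W) (hd : d ≤ degIn G W v) :
    (awayFrom G W v).card ≤ W.card - 1 - d := by
  have := card_awayFrom (G := G) hv
  omega

lemma card_stableIn_awayFrom_le_geom {W : Finset V} {v : V} {k d : ℕ} (h : StableBound G W k)
    (hv : v ∈ W) (hd : d ≤ degIn G W v) :
    ((stableIn G (awayFrom G W v)).card : ℝ) ≤
      (4 / 3) ^ (k - 1) * (3 / 2) ^ (W.card - 1 - d) := by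
  refine (card_stableIn_le_geom (h.awayFrom hv)).trans ?_
  gcongr
  · norm_num
  · exact card_awayFrom_le hv hd

lemma card_stableIn_awayFrom_le_two_pow {W : Finset V} {v : V} {d : ℕ}
    (hv : v ∈ W) (hd : d ≤ degIn G W v) :
    (stableIn G (awayFrom G W v)).card ≤ 2 ^ (W.card - 1 - d) :=
  (card_stableIn_le_two_pow _).trans
    (Nat.pow_le_pow_right (by norm_num) (card_awayFrom_le hv hd))

lemma card_stableIn_erase_le_geom [DecidableEq V] {W : Finset V} {v : V} {k : ℕ}
    (h : StableBound G W k) (hv : v ∈ W) :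
    ((stableIn G (W.erase v)).card : ℝ) ≤ (4 / 3) ^ k * (3 / 2) ^ (W.card - 1) := by
  have := card_stableIn_le_geom (h.mono (Finset.erase_subset v W))
  rwa [Finset.card_erase_of_mem hv] at this

lemma card_stableIn_le_geom_add {W : Finset V} {v : V} {k d : ℕ} (h : StableBound G W k)
    (hv : v ∈ W) (hd : d ≤ degIn G W v) :
    ((stableIn G W).card : ℝ) ≤ (4 / 3) ^ k * (3 / 2) ^ (W.card - 1) +
      (4 / 3) ^ (k - 1) * (3 / 2) ^ (W.card - 1 - d) := by
  classical
  rw [card_stableIn_eq_add hv]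
  push_cast
  exact add_le_add (card_stableIn_erase_le_geom h hv) (card_stableIn_awayFrom_le_geom h hv hd)

lemma degree_le_degIn_erase_add [Fintype V] [DecidableEq V] [DecidableRel G.Adj] (v w : V) :
    G.degree w ≤ degIn G (Finset.univ.erase v) w + if G.Adj v w then 1 else 0 := by
  have h : degIn G (Finset.univ.erase v) w = ((G.neighborFinset w).erase v).card := by
    rw [degIn]
    congr 1
    ext x
    simp
  rw [h, ← SimpleGraph.card_neighborFinset_eq_degree]
  split_ifs with hvw
  · have := Finset.pred_card_le_card_erase (s := G.neighborFinset w) (a := v)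
    omega
  · rw [Finset.erase_eq_of_notMem]
    · simp
    · rw [SimpleGraph.mem_neighborFinset]
      exact fun h => hvw h.symm

/-- Otherwise the degree sum is at most `2 + (n - 1) + 2`, whereas a connected graph has degree sum
at least `2 * (n - 1)`. -/
lemma exists_two_le_degIn_erase [Fintype V] [DecidableEq V] [DecidableRel G.Adj]
    (hG : G.Connected) {v : V} (hv : G.degree v ≤ 2) (hV : 8 ≤ Fintype.card V) :
    ∃ w ∈ Finset.univ.erase v, 2 ≤ degIn G (Finset.univ.erase v) w := by
  by_contra! hcon
  have h1 : ∀ w ∈ Finset.univ.erase v, G.degree w ≤ 1 + if G.Adj v w then 1 else 0 := by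
    intro w hw
    have := hcon w hw
    have := degree_le_degIn_erase_add (G := G) v w
    omega
  have h2 := Finset.sum_le_sum h1
  rw [Finset.sum_add_distrib, Finset.sum_const, Finset.card_erase_of_mem (Finset.mem_univ v),
    Finset.card_univ, smul_eq_mul, mul_one] at h2
  have h3 : ∑ w ∈ Finset.univ.erase v, (if G.Adj v w then 1 else 0) ≤ G.degree v := by
    rw [← Finset.card_filter, ← SimpleGraph.card_neighborFinset_eq_degree]
    apply Finset.card_le_card
    intro w hw
    rw [SimpleGraph.mem_neighborFinset]
    exact (Finset.mem_filter.1 hw).2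
  have h4 := Finset.add_sum_erase Finset.univ (fun w => G.degree w) (Finset.mem_univ v)
  have h5 := G.sum_degrees_eq_twice_card_edges
  have h6 := card_le_card_edgeFinset_add_one hG
  omega

/-- The case `n = 8`, `α = 4`, where a single deletion at a vertex of degree `2` gives only `72`,
above the required `69`. -/
lemma card_stableIn_le_of_card_eq_eight [Fintype V] [DecidableEq V] [DecidableRel G.Adj]
    (hG : G.Connected) (hV : Fintype.card V = 8) (hk : G.indepNum = 4) :
    ((stableIn G Finset.univ).card : ℝ) ≤ 66 := by
  have hB := stableBound_univ G
  rw [hk] at hB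
  by_cases h3 : ∃ v, 3 ≤ G.degree v
  · obtain ⟨v, hv⟩ := h3
    rw [← degIn_univ] at hv
    -- A vertex of degree at least `3` gives `54 + 12`.
    have := card_stableIn_le_geom_add hB (Finset.mem_univ v) hv
    rw [Finset.card_univ, hV] at this
    norm_num at this
    exact_mod_cast this
  · push Not at h3
    obtain ⟨v, hv⟩ := exists_card_le_mul_degree hG (by omega)
    rw [hV, hk] at hv
    have hv2 : 2 ≤ G.degree v := by omega
    -- With all degrees at most `2`, a second deletion at `w` improves the first term from `54` to
    -- `36 + 12`; the second term is `18`.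
    obtain ⟨w, hw, hw2⟩ := exists_two_le_degIn_erase hG (Nat.le_of_lt_succ (h3 v)) hV.ge
    have h1 := card_stableIn_le_geom_add (hB.mono (Finset.erase_subset v _)) hw hw2
    rw [← degIn_univ] at hv2
    have h2 := card_stableIn_awayFrom_le_geom hB (Finset.mem_univ v) hv2
    rw [card_stableIn_eq_add (Finset.mem_univ v)]
    rw [Finset.card_erase_of_mem (Finset.mem_univ v)] at h1
    rw [Finset.card_univ, hV] at h1 h2
    norm_num at h1 h2
    exact_mod_cast add_le_add h1 h2

end UpperBound

/-! ### Numerical inequalities, with `i = α - 1` and `j = n - 1 - α` -/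

section Numerics

lemma le_upperBound_iff {i j : ℕ} (hij : 0 < i + j) (y : ℝ) :
    y ≤ upperBound (i + j + 2) ((i + 1 : ℕ) : ℝ) ↔
      y * (i + j) ≤ i * 2 ^ (i + j + 1) + j * (i + j + 2) + (i + j) := by
  have h0 : (0 : ℝ) < i + j := by exact_mod_cast hij
  have h : upperBound (i + j + 2) ((i + 1 : ℕ) : ℝ) =
      (i * 2 ^ (i + j + 1) + j * (i + j + 2) + (i + j)) / (i + j) := by
    unfold upperBound
    rw [show i + j + 2 - 1 = i + j + 1 by omega]
    push_cast
    rw [show (i : ℝ) + j + 2 - 2 = i + j by ring]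
    field_simp
    ring
  rw [h, le_div_iff₀ h0]

lemma four_thirds_pow_mul_three_halves_pow (i j : ℕ) :
    (4 / 3 : ℝ) ^ i * (3 / 2) ^ (i + j) = 2 ^ i * (3 / 2) ^ j := by
  rw [pow_add, ← mul_assoc, ← mul_pow]
  norm_num

lemma add_two_le_four_thirds_pow {m : ℕ} (hm : 9 ≤ m) : (m : ℝ) + 2 ≤ (4 / 3) ^ m := by
  induction m, hm using Nat.le_induction with
  | base => norm_num
  | succ m hm ih =>
    rw [pow_succ]
    have : (9 : ℝ) ≤ m := by exact_mod_cast hm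
    push_cast
    linarith

/-- What remains of the upper inequality, with `j = m + 1`, after the bound `4 * 2 ^ i * (3/2) ^ m`
on `F`. The pairs excluded by `hex` are handled by other estimates. -/
lemma add_le_mul_four_thirds_pow {i m : ℕ} (hi : 1 ≤ i) (hm : 2 ≤ m) (h : 5 ≤ i + m)
    (hex : 9 ≤ m ∨ 3 ≤ i ∧ ¬ (i = 3 ∧ m = 2) ∨ i = 2 ∧ 5 ≤ m) :
    (i + m + 1 : ℝ) ≤ i * (4 / 3) ^ m := by
  have hi' : (1 : ℝ) ≤ i := by exact_mod_cast hi
  by_cases h9 : 9 ≤ m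
  · have := add_two_le_four_thirds_pow h9
    nlinarith [mul_le_mul_of_nonneg_left this (by linarith : (0 : ℝ) ≤ i),
      mul_nonneg (sub_nonneg.2 hi') (by positivity : (0 : ℝ) ≤ m)]
  · have hm2 : m ≤ 8 := by omega
    obtain h4 | h3 | h2 : 4 ≤ i ∨ (i = 3 ∧ 3 ≤ m) ∨ (i = 2 ∧ 5 ≤ m) := by omega
    · have : (4 : ℝ) ≤ i := by exact_mod_cast h4
      interval_cases m <;> norm_num <;> linarith
    · obtain ⟨rfl, h3⟩ := h3
      interval_cases m <;> norm_num
    · obtain ⟨rfl, h2⟩ := h2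
      interval_cases m <;> norm_num

end Numerics

/-- The extreme values `i = 0` and `j = 0` are tight. For `j = 1, 2` the degree of `v` must be
exploited beyond `2`; for most larger `j`, degree `2` suffices. -/
theorem fibonacciIndex_le_upperBound {V : Type*} [Fintype V] {G : SimpleGraph V}
    (hG : G.Connected) (hV : 8 ≤ Fintype.card V) :
    (fibonacciIndex G : ℝ) ≤ upperBound (Fintype.card V) G.indepNum := by
  classical
  rw [fibonacciIndex_eq_card_stableIn]
  have hB := stableBound_univ G
  obtain ⟨v, hv⟩ := exists_card_le_mul_degree hG (by omega)
  have hk1 := hB.pos (Finset.mem_univ v)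
  have hk2 : G.indepNum < Fintype.card V := by
    by_contra! h
    rw [Nat.sub_eq_zero_of_le h] at hv
    omega
  have hg := card_stableIn_le_geom' hB
  obtain ⟨i, hi⟩ : ∃ i, G.indepNum = i + 1 := ⟨G.indepNum - 1, by omega⟩
  obtain ⟨j, hj⟩ : ∃ j, Fintype.card V = i + j + 2 := ⟨Fintype.card V - i - 2, by omega⟩
  have h8 := card_stableIn_le_of_card_eq_eight (V := V) hG
  have hE := card_stableIn_erase_le_geom hB (Finset.mem_univ v)
  have hA : ∀ {d}, d ≤ G.degree v →
      ((stableIn G (awayFrom G Finset.univ v)).card : ℝ) ≤ 2 ^ (i + j + 1 - d) := fun {d} hd => by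
    have := card_stableIn_awayFrom_le_two_pow (Finset.mem_univ v) (hd.trans (degIn_univ v).ge)
    rw [Finset.card_univ, hj, show i + j + 2 - 1 = i + j + 1 by omega] at this
    exact_mod_cast this
  have hsum : ((stableIn G Finset.univ).card : ℝ) = (stableIn G (Finset.univ.erase v)).card +
      (stableIn G (awayFrom G Finset.univ v)).card := by
    exact_mod_cast card_stableIn_eq_add (Finset.mem_univ v)
  have hgeom := fun hd => card_stableIn_le_geom_add (d := 2) hB (Finset.mem_univ v) hd
  rw [degIn_univ] at hgeom
  have hone : G.indepNum = 1 → (stableIn G Finset.univ).card ≤ Fintype.card V + 1 := fun h =>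
    card_stableIn_le_succ_of_stableBound_one (h ▸ hB)
  have hstar : (stableIn G (Finset.univ.erase v)).card ≤ 2 ^ (i + j + 1) := by
    have := card_stableIn_le_two_pow (G := G) (Finset.univ.erase v)
    rwa [Finset.card_erase_of_mem (Finset.mem_univ v), Finset.card_univ, hj] at this
  rw [hj] at hv hV h8 hone ⊢
  rw [hi] at hv hE hg h8 hgeom hone ⊢
  rw [Finset.card_univ, hj] at hE hg hgeom
  rw [show i + j + 2 - (i + 1) = j + 1 by omega] at hv
  rw [show i + j + 2 - 1 = i + j + 1 by omega] at hv hE hgeom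
  rw [Nat.add_sub_cancel] at hgeom
  rw [le_upperBound_iff (by omega)]
  set F : ℝ := ((stableIn G Finset.univ).card : ℝ) with hF
  have hij : (0 : ℝ) < i + j := by exact_mod_cast (by omega : 0 < i + j)
  rw [show i + j + 1 = (i + 1) + j by omega, four_thirds_pow_mul_three_halves_pow] at hE
  rcases Nat.eq_zero_or_pos i with rfl | hi1
  · have h1 : F ≤ j + 3 := by
      rw [hF]
      exact_mod_cast (hone rfl).trans (by omega)
    have := mul_le_mul_of_nonneg_right h1 hij.le
    push_cast at this ⊢
    linarith
  obtain rfl | rfl | rfl | hj3 : j = 0 ∨ j = 1 ∨ j = 2 ∨ 3 ≤ j := by omega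
  -- Here `v` is adjacent to all other vertices, so only the empty set is counted away from it.
  · have h1 : F ≤ 2 ^ (i + 0 + 1) + 1 := by
      have := hA (d := i + 1) (by omega)
      rw [show i + 0 + 1 - (i + 1) = 0 by omega, pow_zero] at this
      rw [hsum]
      exact add_le_add (by exact_mod_cast hstar) this
    have := mul_le_mul_of_nonneg_right h1 hij.le
    push_cast at this ⊢
    linarith
  -- As `n ≥ 8`, `i ≥ 5` and `i + 2 ≤ 2 * G.degree v`, so the degree is at least `4`. The two terms
  -- are at most `12 * 2 ^ t` and `2 ^ t`.
  · have h1 := hA (d := 4) (by omega)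
    obtain ⟨t, rfl⟩ : ∃ t, i = t + 2 := ⟨i - 2, by omega⟩
    have h2 : F ≤ 13 * 2 ^ t := by
      rw [show t + 2 + 1 + 1 - 4 = t by omega] at h1
      rw [hsum]
      rw [show t + 2 + 1 = t + 3 by omega, pow_add] at hE
      linarith
    have ht : (3 : ℝ) ≤ t := by exact_mod_cast (by omega : 3 ≤ t)
    have := mul_le_mul_of_nonneg_right h2 hij.le
    rw [show t + 2 + 1 + 1 = t + 4 by omega, pow_add]
    push_cast at this ⊢
    nlinarith [mul_nonneg (sub_nonneg.2 ht) (by positivity : (0 : ℝ) ≤ 2 ^ t)]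
  -- Now `i ≥ 4` and `i + 3 ≤ 3 * G.degree v`. The two terms are at most `9 * 2 ^ t` and `2 * 2 ^
  -- t`.
  · have h1 := hA (d := 3) (by omega)
    obtain ⟨t, rfl⟩ : ∃ t, i = t + 1 := ⟨i - 1, by omega⟩
    have h2 : F ≤ 11 * 2 ^ t := by
      rw [show t + 1 + 2 + 1 - 3 = t + 1 by omega, pow_succ] at h1
      rw [hsum]
      rw [show t + 1 + 1 = t + 2 by omega, pow_add] at hE
      linarith
    have := mul_le_mul_of_nonneg_right h2 hij.le
    rw [show t + 1 + 2 + 1 = t + 4 by omega, pow_add]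
    refine this.trans ?_
    -- At `t = 3` the lower-order terms are needed: `528 ≤ 534`, with leading term only `512`.
    obtain rfl | h4 : t = 3 ∨ 4 ≤ t := by omega
    · norm_num
    · have ht : (4 : ℝ) ≤ t := by exact_mod_cast h4
      push_cast
      nlinarith [mul_nonneg (sub_nonneg.2 ht) (by positivity : (0 : ℝ) ≤ 2 ^ t)]
  by_cases h33 : i = 3 ∧ j = 3
  · obtain ⟨rfl, rfl⟩ := h33
    have := h8 rfl rfl
    push_cast
    linarith
  obtain ⟨m, rfl⟩ : ∃ m, j = m + 1 := ⟨j - 1, by omega⟩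
  by_cases hex : 9 ≤ m ∨ 3 ≤ i ∧ ¬ (i = 3 ∧ m = 2) ∨ i = 2 ∧ 5 ≤ m
  · have hd : 2 ≤ G.degree v := by
      by_contra! hd
      have := Nat.mul_le_mul_left (m + 1 + 1) (Nat.le_of_lt_succ hd)
      omega
    have h1 := hgeom hd
    rw [show i + (m + 1) + 1 = (i + 1) + (m + 1) by omega, four_thirds_pow_mul_three_halves_pow,
      show i + 1 + (m + 1) - 2 = i + m by omega, four_thirds_pow_mul_three_halves_pow] at h1
    have h2 := add_le_mul_four_thirds_pow hi1 (by omega) (by omega) hex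
    have h3 : (4 / 3 : ℝ) ^ m * (3 / 2) ^ m = 2 ^ m := by rw [← mul_pow]; norm_num
    have h4 : F ≤ 4 * 2 ^ i * (3 / 2) ^ m := by
      rw [pow_succ, pow_succ] at h1
      linarith
    calc F * (i + (m + 1 : ℕ)) ≤ 4 * 2 ^ i * (3 / 2) ^ m * (i + (m + 1 : ℕ)) :=
          mul_le_mul_of_nonneg_right h4 hij.le
      _ = 4 * 2 ^ i * (3 / 2) ^ m * (i + m + 1) := by push_cast; ring
      _ ≤ 4 * 2 ^ i * (3 / 2) ^ m * (i * (4 / 3) ^ m) :=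
          mul_le_mul_of_nonneg_left h2 (by positivity)
      _ = 4 * 2 ^ i * i * ((4 / 3) ^ m * (3 / 2) ^ m) := by ring
      _ = i * 2 ^ (i + (m + 1) + 1) := by rw [h3]; ring
      _ ≤ _ := by
          rw [add_assoc (_ * _)]
          exact le_add_of_nonneg_right (add_nonneg (by positivity) hij.le)
  -- Only `α = 2` or `α = 3` with few vertices is left; there the bound `card_stableIn_le_geom'` is
  -- strong enough.
  · have h2 := mul_le_mul_of_nonneg_right hg hij.le
    refine h2.trans ?_
    have hm : m ≤ 8 := by omega
    obtain rfl | rfl : i = 1 ∨ i = 2 := by omega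
    all_goals
      interval_cases m <;> first | omega | norm_num

/-! ### Complete split graphs, the minimisers of `F` for given `α` -/

section CompleteSplit

variable {V : Type*}

/-- The complete split graph with stable part `S`: two vertices are adjacent unless both of them
lie in `S`. -/
def completeSplit (S : Finset V) : SimpleGraph V where
  Adj u v := u ≠ v ∧ (u ∉ S ∨ v ∉ S)
  symm := ⟨fun _ _ h => ⟨h.1.symm, h.2.symm⟩⟩
  loopless := ⟨fun _ h => h.1 rfl⟩

lemma completeSplit_adj {S : Finset V} {u v : V} :
    (completeSplit S).Adj u v ↔ u ≠ v ∧ (u ∉ S ∨ v ∉ S) := Iff.rfl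

lemma isIndepSet_completeSplit_iff {S s : Finset V} :
    (completeSplit S).IsIndepSet (s : Set V) ↔ s ⊆ S ∨ ∃ v ∉ S, s = {v} := by
  constructor
  · intro h
    by_cases hs : s ⊆ S
    · exact Or.inl hs
    · obtain ⟨v, hv, hvS⟩ := Finset.not_subset.1 hs
      refine Or.inr ⟨v, hvS, Finset.eq_singleton_iff_unique_mem.2 ⟨hv, fun w hw => ?_⟩⟩
      by_contra hwv
      exact h hw hv hwv ⟨hwv, Or.inr hvS⟩
  · rintro (h | ⟨v, -, rfl⟩)
    · intro u hu v hv _ huv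
      exact huv.2.elim (fun hn => hn (h hu)) (fun hn => hn (h hv))
    · simp [SimpleGraph.IsIndepSet]

lemma connected_completeSplit {S : Finset V} {c : V} (hc : c ∉ S) :
    (completeSplit S).Connected := by
  have h : ∀ u, (completeSplit S).Reachable c u := fun u => by
    by_cases hu : c = u
    · rw [hu]
    · exact SimpleGraph.Adj.reachable ⟨hu, Or.inl hc⟩
  exact { preconnected := fun u v => (h u).symm.trans (h v), nonempty := ⟨c⟩ }

lemma completeSplit_singleton (c : V) : completeSplit {c} = ⊤ := by
  ext u v
  simp only [completeSplit_adj, Finset.mem_singleton, SimpleGraph.top_adj, and_iff_left_iff_imp]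
  intro h
  by_contra! h'
  exact h (h'.1.trans h'.2.symm)

variable [Fintype V]

lemma fibonacciIndex_completeSplit (S : Finset V) :
    fibonacciIndex (completeSplit S) = 2 ^ S.card + (Fintype.card V - S.card) := by
  classical
  rw [fibonacciIndex_eq_card_stableIn]
  have h : stableIn (completeSplit S) Finset.univ =
      S.powerset ∪ Sᶜ.map ⟨fun v => ({v} : Finset V), Finset.singleton_injective⟩ := by
    ext s
    simp only [mem_stableIn, Finset.subset_univ, true_and, isIndepSet_completeSplit_iff,
      Finset.mem_union, Finset.mem_powerset, Finset.mem_map, Finset.mem_compl,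
      Function.Embedding.coeFn_mk]
    simp only [eq_comm]
  rw [h, Finset.card_union_of_disjoint, Finset.card_powerset, Finset.card_map, Finset.card_compl]
  rw [Finset.disjoint_left]
  intro s hs hs'
  obtain ⟨v, hv, rfl⟩ := Finset.mem_map.1 hs'
  exact Finset.mem_compl.1 hv (Finset.mem_powerset.1 hs (Finset.mem_singleton_self v))

lemma indepNum_completeSplit {S : Finset V} (hS : S.Nonempty) :
    (completeSplit S).indepNum = S.card := by
  apply le_antisymm
  · obtain ⟨s, hs⟩ := (completeSplit S).exists_isNIndepSet_indepNum
    rw [← hs.2]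
    rcases isIndepSet_completeSplit_iff.1 hs.1 with h | ⟨v, -, h⟩
    · exact Finset.card_le_card h
    · rw [h, Finset.card_singleton]
      exact hS.card_pos
  · exact (isIndepSet_completeSplit_iff.2 (Or.inl subset_rfl)).card_le_indepNum

lemma completeSplit_compl_singleton [DecidableEq V] (c : V) :
    completeSplit {c}ᶜ = SimpleGraph.starGraph c := by
  ext u v
  simp [completeSplit_adj, SimpleGraph.starGraph_adj]

lemma fibonacciIndex_completeSplit_le {G : SimpleGraph V} {S : Finset V}
    (hS : G.IsIndepSet (S : Set V)) : fibonacciIndex (completeSplit S) ≤ fibonacciIndex G := by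
  rw [fibonacciIndex_eq_card_stableIn, fibonacciIndex_eq_card_stableIn]
  apply Finset.card_le_card
  intro s hs
  rw [mem_stableIn, isIndepSet_completeSplit_iff] at hs
  refine mem_stableIn.2 ⟨hs.1, ?_⟩
  rcases hs.2 with h | ⟨v, -, rfl⟩
  · exact hS.mono (by exact_mod_cast h)
  · simp [SimpleGraph.IsIndepSet]

end CompleteSplit

/-! ### The polygon and its description by half-planes -/

section Polygon

/-- The point `(k, 2 ^ k - k + n)`. -/
noncomputable def lowerVertex (n k : ℕ) : ℝ × ℝ := ((k : ℝ), (2 : ℝ) ^ k - k + n)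

lemma graphPoint_completeSplit {n : ℕ} {S : Finset (Fin n)} (hS : S.Nonempty) :
    graphPoint (completeSplit S) = lowerVertex n S.card := by
  have h : S.card ≤ n := by simpa using S.card_le_univ
  rw [graphPoint, lowerVertex, indepNum_completeSplit hS, fibonacciIndex_completeSplit,
    Fintype.card_fin]
  push_cast [h]
  congr 1
  ring

lemma graphPoint_top {n : ℕ} (c : Fin n) :
    graphPoint (⊤ : SimpleGraph (Fin n)) = lowerVertex n 1 := by
  rw [← completeSplit_singleton c, graphPoint_completeSplit (by simp), Finset.card_singleton]

lemma graphPoint_starGraph {n : ℕ} (hn : 2 ≤ n) (c : Fin n) :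
    graphPoint (SimpleGraph.starGraph c) = lowerVertex n (n - 1) := by
  have h : ({c}ᶜ : Finset (Fin n)).card = n - 1 := by
    rw [Finset.card_compl, Finset.card_singleton, Fintype.card_fin]
  rw [← completeSplit_compl_singleton c, graphPoint_completeSplit, h]
  rw [← Finset.card_pos, h]
  omega

lemma lowerVertex_mem_connectedPolytope {n k : ℕ} (hk : 1 ≤ k) (hkn : k + 1 ≤ n) :
    lowerVertex n k ∈ connectedPolytope n := by
  obtain ⟨S, -, hS⟩ := Finset.exists_subset_card_eq (s := (Finset.univ : Finset (Fin n)))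
    (n := k) (by rw [Finset.card_univ, Fintype.card_fin]; omega)
  obtain ⟨c, hc⟩ : ∃ c, c ∉ S := by
    by_contra! h
    rw [Finset.eq_univ_of_forall h, Finset.card_univ, Fintype.card_fin] at hS
    omega
  apply subset_convexHull
  refine ⟨completeSplit S, connected_completeSplit hc, ?_⟩
  rw [graphPoint_completeSplit (Finset.card_pos.1 (by omega)), hS]

lemma lowerVertex_le_graphPoint {n : ℕ} (G : SimpleGraph (Fin n)) :
    (lowerVertex n G.indepNum).2 ≤ (graphPoint G).2 := by
  obtain ⟨S, hS⟩ := G.exists_isNIndepSet_indepNum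
  have h1 := fibonacciIndex_completeSplit_le hS.1
  rw [fibonacciIndex_completeSplit, hS.2, Fintype.card_fin] at h1
  have h : G.indepNum ≤ n := by simpa [hS.2] using S.card_le_univ
  have h2 : ((2 ^ G.indepNum + (n - G.indepNum) : ℕ) : ℝ) ≤ fibonacciIndex G := by
    exact_mod_cast h1
  push_cast [h] at h2
  simp only [lowerVertex, graphPoint]
  linarith

lemma lowerBound_natCast (n l m : ℕ) :
    lowerBound n l m = (lowerVertex n m).2 - (2 ^ m - 2 ^ l * ((m : ℝ) - l + 1)) := by
  simp only [lowerBound, lowerVertex]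
  ring

/-- The gap is `2 ^ m - 2 ^ l * (m - l + 1)`. For `m < l` the subtracted term is nonpositive; for `m
= l + 2 + t` the gap is `2 ^ l * (2 ^ (t + 2) - (t + 3))`. -/
lemma lowerBound_add_one_le {n l m : ℕ} (h : m < l ∨ l + 2 ≤ m) :
    lowerBound n l m + 1 ≤ (lowerVertex n m).2 := by
  rw [lowerBound_natCast]
  rcases h with h | h
  · have h1 : (m : ℝ) + 1 ≤ l := by exact_mod_cast h
    have h2 : (1 : ℝ) ≤ 2 ^ m := one_le_pow₀ (by norm_num)
    nlinarith [mul_nonneg (sub_nonneg.2 h1) (by positivity : (0 : ℝ) ≤ 2 ^ l)]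
  · obtain ⟨t, rfl⟩ := Nat.exists_eq_add_of_le h
    have h1 : (t : ℝ) + 4 ≤ 2 ^ (t + 2) := by
      induction t with
      | zero => norm_num
      | succ t ih =>
        have := ih (by omega)
        rw [show t + 1 + 2 = t + 2 + 1 by omega, pow_succ]
        push_cast
        linarith [(Nat.cast_nonneg t : (0 : ℝ) ≤ t)]
    have h2 : (1 : ℝ) ≤ 2 ^ l := one_le_pow₀ (by norm_num)
    rw [add_assoc, add_comm 2 t, pow_add]
    push_cast
    nlinarith [mul_nonneg (sub_nonneg.2 h1) (by positivity : (0 : ℝ) ≤ 2 ^ l)]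

lemma lowerBound_self (n k : ℕ) : lowerBound n k k = (lowerVertex n k).2 := by
  rw [lowerBound_natCast]
  ring

lemma lowerBound_succ (n k : ℕ) :
    lowerBound n k ((k + 1 : ℕ) : ℝ) = (lowerVertex n (k + 1)).2 := by
  rw [lowerBound_natCast]
  push_cast
  ring

lemma lowerBound_le (n l m : ℕ) : lowerBound n l m ≤ (lowerVertex n m).2 := by
  by_cases h : m < l ∨ l + 2 ≤ m
  · linarith [lowerBound_add_one_le (n := n) h]
  · obtain rfl | rfl : m = l ∨ m = l + 1 := by omega
    · exact (lowerBound_self n m).le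
    · exact (lowerBound_succ n l).le

lemma eq_or_eq_add_one_of_lowerBound_eq {n l m : ℕ}
    (h : (lowerVertex n m).2 = lowerBound n l (lowerVertex n m).1) : m = l ∨ m = l + 1 := by
  by_contra hcon
  have := lowerBound_add_one_le (n := n) (l := l) (m := m) (by omega)
  rw [lowerVertex] at h
  simp only [lowerVertex] at this
  simp only at h
  linarith

/-- Average over the abscissae `k` and `k + 1`: line `l` is nowhere above the two vertices and
passes at least `1` below one of them. -/
lemma lowerBound_add_half_le {n k l : ℕ} (h : l ≠ k) :
    lowerBound n l (k + 1 / 2) ≤ lowerBound n k (k + 1 / 2) - 1 / 2 := by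
  have havg : ∀ i, lowerBound n i (k + 1 / 2) =
      (lowerBound n i k + lowerBound n i ((k + 1 : ℕ) : ℝ)) / 2 := by
    intro i
    simp only [lowerBound]
    push_cast
    ring
  rw [havg, havg, lowerBound_self, lowerBound_succ]
  have h1 := lowerBound_le n l k
  have h2 := lowerBound_le n l (k + 1)
  rcases Nat.lt_or_gt_of_ne h with h | h
  · linarith [lowerBound_add_one_le (n := n) (l := l) (m := k + 1) (by omega)]
  · linarith [lowerBound_add_one_le (n := n) (l := l) (m := k) (by omega)]

/-- The slope of the upper inequality. -/
noncomputable def upperSlope (n : ℕ) : ℝ := ((2 : ℝ) ^ (n - 1) - n) / (n - 2)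

lemma upperBound_eq (n : ℕ) (x : ℝ) : upperBound n x = upperSlope n * (x - 1) + n + 1 := rfl

lemma upperSlope_mul {n : ℕ} (hn : 3 ≤ n) : upperSlope n * (n - 2) = 2 ^ (n - 1) - n := by
  have : (3 : ℝ) ≤ n := by exact_mod_cast hn
  exact div_mul_cancel₀ _ (by linarith)

lemma upperBound_one (n : ℕ) : upperBound n (lowerVertex n 1).1 = (lowerVertex n 1).2 := by
  simp only [upperBound_eq, lowerVertex]
  push_cast
  ring

lemma upperBound_sub_one {n : ℕ} (hn : 3 ≤ n) :
    upperBound n (lowerVertex n (n - 1)).1 = (lowerVertex n (n - 1)).2 := by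
  have h := upperSlope_mul hn
  simp only [upperBound_eq, lowerVertex]
  push_cast [show 1 ≤ n by omega]
  linarith

lemma one_lt_upperSlope {n : ℕ} (hn : 4 ≤ n) : 1 < upperSlope n := by
  obtain ⟨m, rfl⟩ := Nat.exists_eq_add_of_le hn
  have h := upperSlope_mul (n := 4 + m) (by omega)
  have h1 : (m : ℝ) + 1 ≤ 2 ^ m := by exact_mod_cast Nat.lt_two_pow_self
  rw [show 4 + m - 1 = m + 3 by omega, pow_add] at h
  push_cast at h
  have h0 : (0 : ℝ) ≤ m := Nat.cast_nonneg m
  by_contra! hcon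
  nlinarith

lemma upperSlope_lt {n : ℕ} (hn : 4 ≤ n) : upperSlope n < 2 ^ (n - 2) - 1 := by
  obtain ⟨m, rfl⟩ := Nat.exists_eq_add_of_le hn
  have h := upperSlope_mul (n := 4 + m) (by omega)
  rw [show 4 + m - 1 = m + 3 by omega, pow_add] at h
  rw [show 4 + m - 2 = m + 2 by omega, pow_add]
  push_cast at h
  have h0 : (0 : ℝ) ≤ m := Nat.cast_nonneg m
  have h1 : (0 : ℝ) ≤ m * 2 ^ m := by positivity
  by_contra! hcon
  nlinarith

lemma mem_sInter_halfPlanes {n : ℕ} {p : ℝ × ℝ} : p ∈ ⋂₀ halfPlanes n ↔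
    (∀ k, 1 ≤ k → k ≤ n - 2 → lowerBound n k p.1 ≤ p.2) ∧ p.2 ≤ upperBound n p.1 := by
  constructor
  · intro h
    exact ⟨fun k h1 h2 => h _ (Or.inl ⟨k, h1, h2, rfl⟩), h _ (Or.inr rfl)⟩
  · rintro ⟨h1, h2⟩ H (⟨k, hk1, hk2, rfl⟩ | rfl)
    · exact h1 k hk1 hk2
    · exact h2

lemma convex_sInter_halfPlanes (n : ℕ) : Convex ℝ (⋂₀ halfPlanes n) := by
  apply convex_sInter
  rintro H (⟨k, -, -, rfl⟩ | rfl)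
  · intro p hp q hq a b ha hb hab
    obtain rfl : b = 1 - a := by linarith
    have h1 := mul_le_mul_of_nonneg_left (Set.mem_ofPred.1 hp) ha
    have h2 := mul_le_mul_of_nonneg_left (Set.mem_ofPred.1 hq) hb
    simp only [lowerBound, Set.mem_ofPred_eq, Prod.fst_add, Prod.snd_add, Prod.smul_fst,
      Prod.smul_snd, smul_eq_mul] at h1 h2 ⊢
    linarith
  · intro p hp q hq a b ha hb hab
    obtain rfl : b = 1 - a := by linarith
    have h1 := mul_le_mul_of_nonneg_left (Set.mem_ofPred.1 hp) ha
    have h2 := mul_le_mul_of_nonneg_left (Set.mem_ofPred.1 hq) hb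
    simp only [upperBound_eq, Set.mem_ofPred_eq, Prod.fst_add, Prod.snd_add, Prod.smul_fst,
      Prod.smul_snd, smul_eq_mul] at h1 h2 ⊢
    linarith

lemma connectedPolytope_subset {n : ℕ} (hn : 8 ≤ n) :
    connectedPolytope n ⊆ ⋂₀ halfPlanes n := by
  refine convexHull_min ?_ (convex_sInter_halfPlanes n)
  rintro p ⟨G, hG, rfl⟩
  rw [mem_sInter_halfPlanes]
  refine ⟨fun k _ _ => ?_, ?_⟩
  · exact (lowerBound_le n k G.indepNum).trans (lowerVertex_le_graphPoint G)
  · have := fibonacciIndex_le_upperBound hG (by rwa [Fintype.card_fin])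
    rwa [Fintype.card_fin] at this

lemma Convex.mem_of_vertical {P : Set (ℝ × ℝ)} (hP : Convex ℝ P) {x a b y : ℝ}
    (ha : (x, a) ∈ P) (hb : (x, b) ∈ P) (hay : a ≤ y) (hyb : y ≤ b) : (x, y) ∈ P := by
  have hc : Convex ℝ {y : ℝ | (x, y) ∈ P} := by
    intro a ha b hb u v hu hv huv
    have := hP ha hb hu hv huv
    simp only [Prod.smul_mk, Prod.mk_add_mk, ← add_smul, huv, one_smul] at this
    exact this
  exact hc.ordConnected.out ha hb ⟨hay, hyb⟩

lemma Convex.mem_of_line {P : Set (ℝ × ℝ)} (hP : Convex ℝ P) {s t a b x : ℝ}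
    (ha : (a, s * a + t) ∈ P) (hb : (b, s * b + t) ∈ P) (hax : a ≤ x) (hxb : x ≤ b) :
    (x, s * x + t) ∈ P := by
  have hc : Convex ℝ {x : ℝ | (x, s * x + t) ∈ P} := by
    intro a ha b hb u v hu hv huv
    have := hP ha hb hu hv huv
    simp only [Prod.smul_mk, Prod.mk_add_mk, smul_eq_mul] at this
    rw [Set.mem_ofPred, smul_eq_mul, smul_eq_mul]
    convert this using 2
    linear_combination (- t) * huv
  exact hc.ordConnected.out ha hb ⟨hax, hxb⟩

lemma lowerBound_mem_connectedPolytope {n k : ℕ} (hk : 1 ≤ k) (hkn : k + 2 ≤ n) {x : ℝ}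
    (h1 : k ≤ x) (h2 : x ≤ (k + 1 : ℕ)) : (x, lowerBound n k x) ∈ connectedPolytope n := by
  have h3 := lowerVertex_mem_connectedPolytope hk (by omega : k + 1 ≤ n)
  have h4 := lowerVertex_mem_connectedPolytope (k := k + 1) (by omega) hkn
  rw [← Prod.mk.eta (p := lowerVertex n k), ← lowerBound_self] at h3
  rw [← Prod.mk.eta (p := lowerVertex n (k + 1)), ← lowerBound_succ] at h4
  unfold lowerBound at h3 h4 ⊢
  rw [add_assoc] at h3 h4 ⊢
  exact (convex_convexHull ℝ _).mem_of_line h3 h4 h1 h2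

lemma upperBound_mem_connectedPolytope {n : ℕ} (hn : 3 ≤ n) {x : ℝ}
    (h1 : 1 ≤ x) (h2 : x ≤ n - 1) : (x, upperBound n x) ∈ connectedPolytope n := by
  have h3 := lowerVertex_mem_connectedPolytope (n := n) le_rfl (by omega)
  have h4 := lowerVertex_mem_connectedPolytope (n := n) (k := n - 1) (by omega) (by omega)
  rw [← Prod.mk.eta (p := lowerVertex n 1), ← upperBound_one] at h3
  rw [← Prod.mk.eta (p := lowerVertex n (n - 1)), ← upperBound_sub_one hn] at h4
  have h : ∀ x, upperBound n x = upperSlope n * x + (n + 1 - upperSlope n) := fun x => by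
    rw [upperBound_eq]
    ring
  rw [h] at h3 h4 ⊢
  refine (convex_convexHull ℝ _).mem_of_line h3 h4 (by simpa [lowerVertex] using h1) ?_
  simp only [lowerVertex]
  push_cast [show 1 ≤ n by omega]
  exact h2

/-- The upper line meets the first and last lower lines at `x = 1` and `x = n - 1`, and its slope
lies strictly between theirs. -/
lemma fst_mem_Icc_of_mem_halfPlanes {n : ℕ} (hn : 4 ≤ n) {p : ℝ × ℝ}
    (hp : p ∈ ⋂₀ halfPlanes n) : 1 ≤ p.1 ∧ p.1 ≤ n - 1 := by
  rw [mem_sInter_halfPlanes] at hp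
  obtain ⟨hl, hu⟩ := hp
  constructor
  · have h1 := (hl 1 le_rfl (by omega)).trans hu
    rw [upperBound_eq, lowerBound] at h1
    norm_num at h1
    have := one_lt_upperSlope hn
    by_contra! h
    nlinarith
  · have h1 := (hl (n - 2) (by omega) le_rfl).trans hu
    have h2 := upperSlope_mul (n := n) (by omega)
    have h3 := upperSlope_lt hn
    rw [upperBound_eq, lowerBound] at h1
    obtain ⟨m, rfl⟩ := Nat.exists_eq_add_of_le (by omega : 2 ≤ n)
    rw [show 2 + m - 1 = m + 1 by omega, pow_succ] at h2
    rw [show 2 + m - 2 = m by omega] at h1 h3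
    push_cast at h1 h2 h3 ⊢
    by_contra! h
    nlinarith

theorem connectedPolytope_eq {n : ℕ} (hn : 8 ≤ n) : connectedPolytope n = ⋂₀ halfPlanes n := by
  refine (connectedPolytope_subset hn).antisymm fun p hp => ?_
  obtain ⟨h1, h2⟩ := fst_mem_Icc_of_mem_halfPlanes (by omega) hp
  rw [mem_sInter_halfPlanes] at hp
  obtain ⟨k, hk1, hk2, hk3, hk4⟩ : ∃ k : ℕ, 1 ≤ k ∧ k + 2 ≤ n ∧ (k : ℝ) ≤ p.1 ∧
      p.1 ≤ (k + 1 : ℕ) := by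
    have hfl := Nat.floor_le (by linarith : 0 ≤ p.1)
    by_cases h : ⌊p.1⌋₊ + 2 ≤ n
    · refine ⟨⌊p.1⌋₊, Nat.le_floor (by exact_mod_cast h1), h, hfl, ?_⟩
      push_cast
      exact (Nat.lt_floor_add_one p.1).le
    -- At the right end `x = n - 1` the floor is one too large, so the last edge is used.
    · refine ⟨n - 2, by omega, by omega, le_trans ?_ hfl, ?_⟩
      · exact_mod_cast (by omega : n - 2 ≤ ⌊p.1⌋₊)
      · rw [show n - 2 + 1 = n - 1 by omega]
        push_cast [show 1 ≤ n by omega]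
        exact h2
  exact (convex_convexHull ℝ _).mem_of_vertical (lowerBound_mem_connectedPolytope hk1 hk2 hk3 hk4)
    (upperBound_mem_connectedPolytope (by omega) h1 h2) (hp.1 k hk1 (by omega)) hp.2

theorem connectedPolytope_ne_sInter {n : ℕ} (hn : 8 ≤ n) {T : Set (Set (ℝ × ℝ))}
    (hT : T ⊂ halfPlanes n) : connectedPolytope n ≠ ⋂₀ T := by
  intro heq
  obtain ⟨hsub, H, hH, hHT⟩ := Set.ssubset_iff_exists.1 hT
  rcases hH with ⟨k, hk1, hk2, rfl⟩ | rfl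
  -- The point `1/2` below the midpoint of edge `k` violates only inequality `k`.
  · have hz : ((k : ℝ) + 1 / 2, lowerBound n k (k + 1 / 2) - 1 / 2) ∈ connectedPolytope n := by
      rw [heq]
      intro H hH
      rcases hsub hH with ⟨l, -, -, rfl⟩ | rfl
      · exact lowerBound_add_half_le fun h => hHT (h ▸ hH)
      · have hm := lowerBound_mem_connectedPolytope (n := n) hk1 (by omega)
          (by linarith : (k : ℝ) ≤ k + 1 / 2) (by push_cast; linarith)
        have := (mem_sInter_halfPlanes.1 (connectedPolytope_subset hn hm)).2
        rw [Set.mem_ofPred]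
        simp only at this ⊢
        linarith
    have := (mem_sInter_halfPlanes.1 (connectedPolytope_subset hn hz)).1 k hk1 hk2
    simp only at this
    linarith
  -- Without the upper inequality, the vertex of the complete graph can be raised.
  · have hz : ((lowerVertex n 1).1, (lowerVertex n 1).2 + 1) ∈ connectedPolytope n := by
      rw [heq]
      intro H hH
      rcases hsub hH with ⟨l, -, -, rfl⟩ | rfl
      · exact (lowerBound_le n l 1).trans (by simp)
      · exact absurd hH hHT
    have := (mem_sInter_halfPlanes.1 (connectedPolytope_subset hn hz)).2
    simp only [upperBound_one] at this
    linarith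

end Polygon

/-! ### Classification and number of the facets -/

section Facets

/-- A face of a planar set with full span, cut out by a line through two of its points, is a
facet. -/
lemma isFacet_of_line {P : Set (ℝ × ℝ)} (hP : Module.finrank ℝ (vectorSpan ℝ P) = 2) {a b c : ℝ}
    (hb : b ≠ 0) (hle : ∀ p ∈ P, a * p.1 + b * p.2 ≤ c) {p q : ℝ × ℝ} (hp : p ∈ P) (hq : q ∈ P)
    (hpc : a * p.1 + b * p.2 = c) (hqc : a * q.1 + b * q.2 = c) (hpq : p.1 ≠ q.1) :
    IsFacet P {r ∈ P | a * r.1 + b * r.2 = c} := by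
  refine ⟨fun _ => ⟨a • ContinuousLinearMap.fst ℝ ℝ ℝ + b • ContinuousLinearMap.snd ℝ ℝ ℝ, ?_⟩,
    ⟨p, hp, hpc⟩, ?_⟩
  · ext r
    simp only [Set.mem_ofPred_eq, add_apply, smul_apply,
      ContinuousLinearMap.coe_fst', ContinuousLinearMap.coe_snd', smul_eq_mul]
    refine and_congr_right fun hr => ⟨fun h y hy => h ▸ hle y hy, fun h => ?_⟩
    exact (hle r hr).antisymm (hpc ▸ h p hp)
  · rw [hP]
    have hd : p.1 - q.1 ≠ 0 := sub_ne_zero.2 hpq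
    have hspan : vectorSpan ℝ {r ∈ P | a * r.1 + b * r.2 = c} = Submodule.span ℝ {p - q} := by
      apply le_antisymm
      · rw [vectorSpan_def, Submodule.span_le]
        rintro _ ⟨r, ⟨-, hr⟩, r', ⟨-, hr'⟩, rfl⟩
        refine Submodule.mem_span_singleton.2 ⟨(r.1 - r'.1) / (p.1 - q.1), ?_⟩
        ext
        · simp only [Prod.smul_fst, Prod.fst_sub, smul_eq_mul, vsub_eq_sub]
          field_simp
        · simp only [Prod.smul_snd, Prod.snd_sub, smul_eq_mul, vsub_eq_sub]
          rw [div_mul_eq_mul_div, div_eq_iff hd]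
          apply mul_left_cancel₀ hb
          linear_combination (r.1 - r'.1) * (hpc - hqc) - (p.1 - q.1) * (hr - hr')
      · rw [Submodule.span_singleton_le_iff_mem]
        exact vsub_mem_vectorSpan ℝ ⟨hp, hpc⟩ ⟨hq, hqc⟩
    rw [hspan, finrank_span_singleton]
    exact fun h => hd (congrArg Prod.fst h)

/-- Since `l` takes the same value at `p` and `q`, its level set through them is the line joining
them, which is the given line. -/
lemma eq_of_exposed_of_line {P B : Set (ℝ × ℝ)} {l : StrongDual ℝ (ℝ × ℝ)}
    (hB : B = {x ∈ P | ∀ y ∈ P, l y ≤ l x}) (hl : l ≠ 0) {p q : ℝ × ℝ} (hp : p ∈ B) (hq : q ∈ B)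
    (hpq : p ≠ q) {a b c : ℝ} (hb : b ≠ 0) (hpc : a * p.1 + b * p.2 = c)
    (hqc : a * q.1 + b * q.2 = c) : B = {r ∈ P | a * r.1 + b * r.2 = c} := by
  have happ : ∀ r : ℝ × ℝ, l r = l (1, 0) * r.1 + l (0, 1) * r.2 := fun r => by
    conv_lhs => rw [show r = r.1 • ((1 : ℝ), (0 : ℝ)) + r.2 • ((0 : ℝ), (1 : ℝ)) by ext <;> simp]
    rw [map_add, map_smul, map_smul, smul_eq_mul, smul_eq_mul]
    ring
  have hp' := hB ▸ hp
  have hq' := hB ▸ hq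
  have hlpq : l p = l q := (hq'.2 p hp'.1).antisymm (hp'.2 q hq'.1)
  have hmem : ∀ r, r ∈ B ↔ r ∈ P ∧ l r = l p := fun r => by
    rw [hB]
    refine and_congr_right fun hr => ⟨fun h => (hp'.2 r hr).antisymm (h p hp'.1), fun h y hy => ?_⟩
    rw [h]
    exact hp'.2 y hy
  have hfst : p.1 - q.1 ≠ 0 := by
    intro h
    refine hpq (Prod.ext (sub_eq_zero.1 h) (mul_left_cancel₀ hb ?_))
    linear_combination hpc - hqc - a * h
  rw [happ p, happ q] at hlpq
  set α := l (1, 0)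
  set β := l (0, 1)
  -- Both `(α, β)` and `(a, b)` annihilate `p - q`, hence they are proportional.
  have hdet : α * b = β * a := by
    apply mul_right_cancel₀ hfst
    linear_combination b * hlpq - β * (hpc - hqc)
  have hβ : β ≠ 0 := by
    intro h
    have hα : α = 0 := by
      rw [h, zero_mul] at hdet
      exact (mul_eq_zero.1 hdet).resolve_right hb
    apply hl
    ext <;> simp [happ, hα, h]
  ext r
  rw [hmem, happ r, happ p, Set.mem_ofPred_eq]
  refine and_congr_right fun _ => ⟨fun h => ?_, fun h => ?_⟩
  · apply mul_left_cancel₀ hβ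
    linear_combination b * h - (r.1 - p.1) * hdet + β * hpc
  · apply mul_left_cancel₀ hb
    linear_combination β * (h - hpc) + (r.1 - p.1) * hdet

variable {n : ℕ}

lemma finrank_vectorSpan_connectedPolytope (hn : 4 ≤ n) :
    Module.finrank ℝ (vectorSpan ℝ (connectedPolytope n)) = 2 := by
  have h1 := lowerVertex_mem_connectedPolytope (n := n) (k := 1) le_rfl (by omega)
  have h2 := lowerVertex_mem_connectedPolytope (n := n) (k := 2) (by omega) (by omega)
  have h3 := lowerVertex_mem_connectedPolytope (n := n) (k := 3) (by omega) (by omega)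
  have h21 := vsub_mem_vectorSpan ℝ h2 h1
  have h32 := vsub_mem_vectorSpan ℝ h3 h2
  have htop : vectorSpan ℝ (connectedPolytope n) = ⊤ := by
    rw [eq_top_iff]
    intro v _
    -- The differences are `(1, 1)` and `(1, 3)`; these are the coordinates of `v` in that basis.
    have := Submodule.add_mem _ (Submodule.smul_mem _ ((3 * v.1 - v.2) / 2) h21)
      (Submodule.smul_mem _ ((v.2 - v.1) / 2) h32)
    convert this using 1
    ext
    · simp [lowerVertex]
      ring
    · simp [lowerVertex]
      ring
  rw [htop, finrank_top, Module.finrank_prod, Module.finrank_self]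

/-- The edges of the polytope: `0` stands for the upper one. -/
noncomputable def polytopeEdge (n k : ℕ) : Set (ℝ × ℝ) :=
  {p ∈ connectedPolytope n | p.2 = if k = 0 then upperBound n p.1 else lowerBound n k p.1}

lemma polytopeEdge_zero (n : ℕ) :
    polytopeEdge n 0 = {p ∈ connectedPolytope n | p.2 = upperBound n p.1} := by
  simp [polytopeEdge]

lemma polytopeEdge_of_pos {k : ℕ} (hk : 1 ≤ k) :
    polytopeEdge n k = {p ∈ connectedPolytope n | p.2 = lowerBound n k p.1} := by
  simp [polytopeEdge, Nat.one_le_iff_ne_zero.1 hk]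

lemma eq_upperBound_iff (p : ℝ × ℝ) : p.2 = upperBound n p.1 ↔
    -upperSlope n * p.1 + 1 * p.2 = n + 1 - upperSlope n := by
  rw [upperBound_eq]
  constructor <;> intro h <;> linarith

lemma eq_lowerBound_iff {k : ℕ} (p : ℝ × ℝ) : p.2 = lowerBound n k p.1 ↔
    (2 ^ k - 1) * p.1 + (-1) * p.2 = -(2 ^ k * (1 - (k : ℝ)) + n) := by
  rw [lowerBound]
  constructor <;> intro h <;> linarith

lemma polytopeEdge_zero' (n : ℕ) : polytopeEdge n 0 =
    {p ∈ connectedPolytope n | -upperSlope n * p.1 + 1 * p.2 = n + 1 - upperSlope n} := by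
  simp only [polytopeEdge_zero, eq_upperBound_iff]

lemma polytopeEdge_of_pos' {k : ℕ} (hk : 1 ≤ k) : polytopeEdge n k =
    {p ∈ connectedPolytope n |
      (2 ^ k - 1) * p.1 + (-1) * p.2 = -(2 ^ k * (1 - (k : ℝ)) + n)} := by
  simp only [polytopeEdge_of_pos hk, eq_lowerBound_iff]

lemma lowerVertex_mem_polytopeEdge {k : ℕ} (hk : 1 ≤ k) (hkn : k + 2 ≤ n) :
    lowerVertex n k ∈ polytopeEdge n k ∧ lowerVertex n (k + 1) ∈ polytopeEdge n k := by
  rw [polytopeEdge_of_pos hk]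
  exact ⟨⟨lowerVertex_mem_connectedPolytope hk (by omega), (lowerBound_self n k).symm⟩,
    lowerVertex_mem_connectedPolytope (by omega) hkn, (lowerBound_succ n k).symm⟩

lemma lowerVertex_mem_polytopeEdge_zero (hn : 3 ≤ n) :
    lowerVertex n 1 ∈ polytopeEdge n 0 ∧ lowerVertex n (n - 1) ∈ polytopeEdge n 0 := by
  rw [polytopeEdge_zero]
  exact ⟨⟨lowerVertex_mem_connectedPolytope le_rfl (by omega), (upperBound_one n).symm⟩,
    lowerVertex_mem_connectedPolytope (by omega) (by omega), (upperBound_sub_one hn).symm⟩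

lemma isFacet_polytopeEdge (hn : 8 ≤ n) {k : ℕ} (hk : k ≤ n - 2) :
    IsFacet (connectedPolytope n) (polytopeEdge n k) := by
  have hP := finrank_vectorSpan_connectedPolytope (n := n) (by omega)
  have hle := fun p hp => mem_sInter_halfPlanes.1 (connectedPolytope_subset hn (a := p) hp)
  rcases Nat.eq_zero_or_pos k with rfl | hk1
  · obtain ⟨h1, h2⟩ := lowerVertex_mem_polytopeEdge_zero (n := n) (by omega)
    rw [polytopeEdge_zero'] at h1 h2 ⊢
    refine isFacet_of_line hP one_ne_zero (fun p hp => ?_) h1.1 h2.1 h1.2 h2.2 ?_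
    · have := (hle p hp).2
      rw [upperBound_eq] at this
      linarith
    · simp only [lowerVertex]
      exact_mod_cast (by omega : 1 ≠ n - 1)
  · obtain ⟨h1, h2⟩ := lowerVertex_mem_polytopeEdge (n := n) hk1 (by omega)
    rw [polytopeEdge_of_pos' hk1] at h1 h2 ⊢
    refine isFacet_of_line hP (by norm_num) (fun p hp => ?_) h1.1 h2.1 h1.2 h2.2 ?_
    · have := (hle p hp).1 k hk1 hk
      rw [lowerBound] at this
      linarith
    · simp [lowerVertex]

/-- If all the finitely many inequalities were strict at `z`, then `z` would be interior and a local
maximum of `l`, forcing the derivative `l` to vanish. -/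
lemma exists_eq_bound_of_forall_le (hn : 8 ≤ n) {l : StrongDual ℝ (ℝ × ℝ)} (hl : l ≠ 0)
    {z : ℝ × ℝ} (hz : z ∈ connectedPolytope n) (hmax : ∀ y ∈ connectedPolytope n, l y ≤ l z) :
    (∃ k, 1 ≤ k ∧ k ≤ n - 2 ∧ z.2 = lowerBound n k z.1) ∨ z.2 = upperBound n z.1 := by
  by_contra! hcon
  have hz' := mem_sInter_halfPlanes.1 (connectedPolytope_subset hn hz)
  have hev : ∀ᶠ w in nhds z, w ∈ connectedPolytope n := by
    have h1 : ∀ᶠ w : ℝ × ℝ in nhds z, ∀ k ∈ Finset.Icc 1 (n - 2), lowerBound n k w.1 < w.2 := by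
      rw [Filter.eventually_all_finset]
      intro k hk
      rw [Finset.mem_Icc] at hk
      have hc : Continuous fun w : ℝ × ℝ => lowerBound n k w.1 := by
        unfold lowerBound
        fun_prop
      exact hc.continuousAt.eventually_lt continuousAt_snd
        ((hz'.1 k hk.1 hk.2).lt_of_ne (hcon.1 k hk.1 hk.2).symm)
    have h2 : ∀ᶠ w : ℝ × ℝ in nhds z, w.2 < upperBound n w.1 := by
      have hc : Continuous fun w : ℝ × ℝ => upperBound n w.1 := by
        unfold upperBound
        fun_prop
      exact continuousAt_snd.eventually_lt hc.continuousAt (hz'.2.lt_of_ne hcon.2)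
    filter_upwards [h1, h2] with w hw1 hw2
    rw [connectedPolytope_eq hn, mem_sInter_halfPlanes]
    exact ⟨fun k hk1 hk2 => (hw1 k (Finset.mem_Icc.2 ⟨hk1, hk2⟩)).le, hw2.le⟩
  have hloc : IsLocalMax l z := by
    filter_upwards [hev] with w hw using hmax w hw
  apply hl
  rw [← hloc.fderiv_eq_zero, ContinuousLinearMap.fderiv]

theorem isFacet_connectedPolytope_iff (hn : 8 ≤ n) {B : Set (ℝ × ℝ)} :
    IsFacet (connectedPolytope n) B ↔ ∃ k ≤ n - 2, B = polytopeEdge n k := by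
  refine ⟨?_, fun ⟨k, hk, hB⟩ => hB ▸ isFacet_polytopeEdge hn hk⟩
  rintro ⟨hexp, hne, hdim⟩
  obtain ⟨l, hB⟩ := hexp hne
  rw [finrank_vectorSpan_connectedPolytope (by omega)] at hdim
  have hl : l ≠ 0 := by
    rintro rfl
    have hBP : B = connectedPolytope n := by simpa using hB
    rw [hBP, finrank_vectorSpan_connectedPolytope (by omega)] at hdim
    omega
  have hnt : B.Nontrivial := by
    rw [← Set.not_subsingleton_iff]
    intro hs
    rw [vectorSpan_of_subsingleton ℝ hs, finrank_bot] at hdim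
    omega
  obtain ⟨p, hp, q, hq, hpq⟩ := hnt
  have hp' := hB ▸ hp
  have hq' := hB ▸ hq
  -- The midpoint also maximises `l`, so some inequality is tight there; as it holds at `p` and `q`,
  -- it is tight at both.
  have hz : (1 / 2 : ℝ) • p + (1 / 2 : ℝ) • q ∈ connectedPolytope n :=
    convex_convexHull ℝ _ hp'.1 hq'.1 (by norm_num) (by norm_num) (by norm_num)
  have hmax : ∀ y ∈ connectedPolytope n, l y ≤ l ((1 / 2 : ℝ) • p + (1 / 2 : ℝ) • q) := by
    intro y hy
    have h1 := hp'.2 y hy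
    have h2 := hq'.2 y hy
    rw [map_add, map_smul, map_smul, smul_eq_mul, smul_eq_mul]
    linarith
  have hle := fun p hp => mem_sInter_halfPlanes.1 (connectedPolytope_subset hn (a := p) hp)
  rcases exists_eq_bound_of_forall_le hn hl hz hmax with ⟨k, hk1, hk2, h⟩ | h
  · have h1 := (hle p hp'.1).1 k hk1 hk2
    have h2 := (hle q hq'.1).1 k hk1 hk2
    refine ⟨k, hk2, ?_⟩
    rw [polytopeEdge_of_pos' hk1]
    simp only [lowerBound, Prod.fst_add, Prod.snd_add, Prod.smul_fst, Prod.smul_snd,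
      smul_eq_mul] at h h1 h2
    exact eq_of_exposed_of_line hB hl hp hq hpq (by norm_num) (by linarith) (by linarith)
  · have h1 := (hle p hp'.1).2
    have h2 := (hle q hq'.1).2
    refine ⟨0, Nat.zero_le _, ?_⟩
    rw [polytopeEdge_zero']
    simp only [upperBound_eq, Prod.fst_add, Prod.snd_add, Prod.smul_fst, Prod.smul_snd,
      smul_eq_mul] at h h1 h2
    exact eq_of_exposed_of_line hB hl hp hq hpq one_ne_zero (by linarith) (by linarith)

lemma eq_or_of_lowerVertex_mem_polytopeEdge {k m : ℕ} (hk : 1 ≤ k)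
    (h : lowerVertex n m ∈ polytopeEdge n k) : m = k ∨ m = k + 1 := by
  rw [polytopeEdge_of_pos hk] at h
  exact eq_or_eq_add_one_of_lowerBound_eq h.2

/-- Edges are told apart by the vertices on them: lower edge `k` contains only those with index `k`
and `k + 1`, the upper edge those with index `1` and `n - 1`. -/
lemma polytopeEdge_injOn (hn : 4 ≤ n) :
    Set.InjOn (polytopeEdge n) (Finset.range (n - 1) : Set ℕ) := by
  have hzero : ∀ k, 1 ≤ k → polytopeEdge n k ≠ polytopeEdge n 0 := by
    intro k hk h
    obtain ⟨h1, h2⟩ := lowerVertex_mem_polytopeEdge_zero (n := n) (by omega)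
    rw [← h] at h1 h2
    have := eq_or_of_lowerVertex_mem_polytopeEdge hk h1
    have := eq_or_of_lowerVertex_mem_polytopeEdge hk h2
    omega
  intro k hk l hl h
  rw [Finset.coe_range, Set.mem_Iio] at hk hl
  rcases Nat.eq_zero_or_pos k with rfl | hk1 <;> rcases Nat.eq_zero_or_pos l with rfl | hl1
  · rfl
  · exact absurd h.symm (hzero l hl1)
  · exact absurd h (hzero k hk1)
  · obtain ⟨h1, h2⟩ := lowerVertex_mem_polytopeEdge (n := n) hk1 (by omega)
    rw [h] at h1 h2
    have := eq_or_of_lowerVertex_mem_polytopeEdge hl1 h1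
    have := eq_or_of_lowerVertex_mem_polytopeEdge hl1 h2
    omega

theorem ncard_facets_connectedPolytope (hn : 8 ≤ n) :
    {B : Set (ℝ × ℝ) | IsFacet (connectedPolytope n) B}.ncard = n - 1 := by
  have h : {B : Set (ℝ × ℝ) | IsFacet (connectedPolytope n) B} =
      polytopeEdge n '' (Finset.range (n - 1) : Set ℕ) := by
    ext B
    simp only [Set.mem_ofPred_eq, isFacet_connectedPolytope_iff hn, Finset.coe_range,
      Set.mem_image, Set.mem_Iio]
    constructor
    · rintro ⟨k, hk, rfl⟩
      exact ⟨k, by omega, rfl⟩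
    · rintro ⟨k, hk, rfl⟩
      exact ⟨k, by omega, rfl⟩
  rw [h, (polytopeEdge_injOn (by omega)).ncard_image, Set.ncard_coe_finset,
    Finset.card_range]

theorem upperBound_line_eq_affineSpan (hn : 3 ≤ n) (c : Fin n) :
    {p : ℝ × ℝ | p.2 = upperBound n p.1} =
      (affineSpan ℝ {graphPoint (⊤ : SimpleGraph (Fin n)), graphPoint (SimpleGraph.starGraph c)} :
        Set (ℝ × ℝ)) := by
  rw [graphPoint_top c, graphPoint_starGraph (by omega) c]
  have h3 : (3 : ℝ) ≤ n := by exact_mod_cast hn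
  have h2 : (n : ℝ) - 2 ≠ 0 := by linarith
  have hs := upperSlope_mul hn
  have hmem : ∀ r : ℝ, AffineMap.lineMap (lowerVertex n 1) (lowerVertex n (n - 1)) r =
      (r * (n - 2) + 1, r * (upperSlope n * (n - 2)) + n + 1) := by
    intro r
    rw [hs, AffineMap.lineMap_apply_module]
    ext
    · simp only [lowerVertex, Prod.smul_mk, Prod.mk_add_mk, smul_eq_mul]
      push_cast [show 1 ≤ n by omega]
      ring
    · simp only [lowerVertex, Prod.smul_mk, Prod.mk_add_mk, smul_eq_mul]
      push_cast [show 1 ≤ n by omega]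
      ring
  ext p
  rw [Set.mem_ofPred_eq, SetLike.mem_coe, mem_affineSpan_pair_iff_exists_lineMap_eq]
  constructor
  · intro h
    refine ⟨(p.1 - 1) / (n - 2), ?_⟩
    rw [hmem]
    ext
    · simp only
      rw [div_mul_cancel₀ _ h2]
      ring
    · simp only
      rw [h, upperBound_eq]
      field_simp
  · rintro ⟨r, rfl⟩
    rw [hmem, upperBound_eq]
    ring

end Facets

theorem theorem5p2 (n : ℕ) (hn : 8 ≤ n) :
    -- the inequalities form a complete and minimal description of the polytope
    connectedPolytope n = ⋂₀ halfPlanes n ∧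
    (∀ T : Set (Set (ℝ × ℝ)), T ⊂ halfPlanes n → connectedPolytope n ≠ ⋂₀ T) ∧
    -- each inequality defines a facet, and there is no other facet
    (∀ B : Set (ℝ × ℝ), IsFacet (connectedPolytope n) B ↔
      (∃ k : ℕ, 1 ≤ k ∧ k ≤ n - 2 ∧
        B = {p ∈ connectedPolytope n | p.2 = lowerBound n k p.1}) ∨
      B = {p ∈ connectedPolytope n | p.2 = upperBound n p.1}) ∧
    -- there are exactly `n - 1` facets
    {B : Set (ℝ × ℝ) | IsFacet (connectedPolytope n) B}.ncard = n - 1 ∧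
    -- the upper line is the line through the points of the complete graph and of the star
    (∀ c : Fin n, {p : ℝ × ℝ | p.2 = upperBound n p.1} =
      (affineSpan ℝ {graphPoint (⊤ : SimpleGraph (Fin n)), graphPoint (SimpleGraph.starGraph c)} :
        Set (ℝ × ℝ))) := by
  refine ⟨connectedPolytope_eq hn, fun T hT => connectedPolytope_ne_sInter hn hT, fun B => ?_,
    ncard_facets_connectedPolytope hn, upperBound_line_eq_affineSpan (by omega)⟩
  rw [isFacet_connectedPolytope_iff hn, ← polytopeEdge_zero]
  constructor
  · rintro ⟨k, hk, rfl⟩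
    rcases Nat.eq_zero_or_pos k with rfl | hk1
    · exact Or.inr rfl
    · exact Or.inl ⟨k, hk1, hk, polytopeEdge_of_pos hk1⟩
  · rintro (⟨k, hk1, hk, rfl⟩ | rfl)
    · exact ⟨k, hk, (polytopeEdge_of_pos hk1).symm⟩
    · exact ⟨0, Nat.zero_le _, rfl⟩
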